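/- Let $k$ be a field of characteristic $0$, let $\mathfrak g$ be a (not necessarily finite-dimensional) Lie algebra over $k$, and let $\mathcal U(\mathfrak g)$ be its universal enveloping algebra, with comultiplication the algebra morphism $\Delta:\mathcal U(\mathfrak g)\to\mathcal U(\mathfrak g)\otimes\mathcal U(\mathfrak g)$ determined by $\Delta(x)=x\otimes 1+1\otimes x$ for $x\in\mathfrak g$. For linear forms $S,T\in\mathcal U(\mathfrak g)^*$, let $S\star T\in\mathcal U(\mathfrak g)^*$ be their convolution product, $\langle S\star T,u\rangle=\langle S\otimes T,\Delta(u)\rangle$. Let $I$ be a set, let $\mathbb N^{(I)}$ be the set of finitely supported families of natural numbers indexed by $I$, and let $e_i\in\mathbb N^{(I)}$ be given by $e_i(j)=\delta_{ij}$. Let $(T_\alpha)_{\alpha\in\mathbb N^{(I)}}$ be a family of linear forms on $\mathcal U(\mathfrak g)$ such that $T_\alpha\star T_\beta=T_{\alpha+\beta}$ for all $\alpha,\beta\in\mathbb N^{(I)}$, and suppose that it is in duality with some basis $(B^{[\alpha]})_{\alpha\in\mathbb N^{(I)}}$ of the vector space $\mathcal U(\mathfrak g)$, that is, $\langle T_\alpha,B^{[\beta]}\rangle=\delta_{\alpha\beta}$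 for all $\alpha,\beta$. Then $(B^{[e_i]})_{i\in I}$ is a basis of $\mathfrak g$, where $\mathfrak g$ is identified with its image in $\mathcal U(\mathfrak g)$ under the canonical map. -/

import Mathlib

open scoped TensorProduct

namespace EnvelopingDuality

section

attribute [local instance 100] LieRing.ofAssociativeRing

variable (k : Type*) (g : Type*) [CommRing k] [LieRing g] [LieAlgebra k g]

/-- The Lie algebra morphism `x ↦ x ⊗ 1 + 1 ⊗ x` from `g` to `U(g) ⊗ U(g)`. -/
noncomputable def primitiveHom :
    g →ₗ⁅k⁆ UniversalEnvelopingAlgebra k g ⊗[k] UniversalEnvelopingAlgebra k g :=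
  { toFun := fun x => UniversalEnvelopingAlgebra.ι k x ⊗ₜ[k] 1 +
      1 ⊗ₜ[k] UniversalEnvelopingAlgebra.ι k x
    map_add' := fun x y => by
      simp only [map_add, TensorProduct.add_tmul, TensorProduct.tmul_add]
      abel
    map_smul' := fun c x => by
      simp only [map_smul, TensorProduct.smul_tmul', TensorProduct.tmul_smul, smul_add,
        RingHom.id_apply]
    map_lie' := fun {x y} => by
      simp only [LieHom.map_lie, LieRing.of_associative_ring_bracket, mul_add, add_mul,
        Algebra.TensorProduct.tmul_mul_tmul, one_mul, mul_one, TensorProduct.sub_tmul,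
        TensorProduct.tmul_sub]
      abel }

/-- The comultiplication of the enveloping algebra `U(g)`: the algebra morphism
`Δ : U(g) → U(g) ⊗ U(g)` with `Δ(x) = x ⊗ 1 + 1 ⊗ x` for `x ∈ g`. -/
noncomputable def comul : UniversalEnvelopingAlgebra k g →ₐ[k]
    UniversalEnvelopingAlgebra k g ⊗[k] UniversalEnvelopingAlgebra k g :=
  UniversalEnvelopingAlgebra.lift k (primitiveHom k g)

theorem comul_ι (x : g) : comul k g (UniversalEnvelopingAlgebra.ι k x) =
    UniversalEnvelopingAlgebra.ι k x ⊗ₜ[k] 1 + 1 ⊗ₜ[k] UniversalEnvelopingAlgebra.ι k x :=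
  UniversalEnvelopingAlgebra.lift_ι_apply k (primitiveHom k g) x

variable {k g}

/-- The convolution product of two linear forms on `U(g)`:
`⟨S ⋆ T, u⟩ = ⟨S ⊗ T, Δ(u)⟩`. -/
noncomputable def conv (S T : Module.Dual k (UniversalEnvelopingAlgebra k g)) :
    Module.Dual k (UniversalEnvelopingAlgebra k g) :=
  LinearMap.mul' k k ∘ₗ TensorProduct.map S T ∘ₗ (comul k g).toLinearMap

end

end EnvelopingDuality

/-!
The proof has two independent halves.

Since the `T α` are dual to the basis `B`, they are its coordinate forms, and
`T α ⋆ T β = T (α + β)` says that `Δ (B γ) = ∑ B α ⊗ B β` over `α + β = γ`. The coordinates of `1`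
form a multiplicative character of `ℕ^(I)` of finite support, so `B 0 = 1` (`basis_zero_eq_one`).
Hence each `B eᵢ` is primitive (`comul_basis_single`), and comparing coordinates of
`Δ x = x ⊗ 1 + 1 ⊗ x` shows that conversely every `x ∈ g` lies in the span of the `B eᵢ`
(`repr_ι_eq_zero`). It remains to know that primitive elements of `U(g)` lie in `g`
(`eigenspace_adams_two`) and that `g` embeds into `U(g)` (`ι_injective`).

Both facts come from the Adams operation `Ψ = μ ∘ Δ` on `U(g)`, for which primitive elements are
eigenvectors with eigenvalue `2`. It acts as `2 ^ n` on the `n`-th graded piece of the degree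
filtration (`adams_sub_mem`). In characteristic zero these numbers are distinct, so `U(g)` is the
direct sum of the eigenspaces of `Ψ` for the powers of `2`, and the eigenspace for `2` is the image
of `g`.

For the injectivity of `g → U(g)`, a free Lie algebra `F` is treated first. It has a derivation fixing
the generators, whose eigenvalues are positive integers and which is therefore injective. This
derivation turns the adjoint representation into a faithful affine one, so `F → U(F)` is
injective (`freeLie_ι_injective`). The projection of `U(F)` onto the eigenspace `F` of `Ψ` is
natural in `F`. For the free Lie algebra `F` on the set `g`, naturality under the substitutions of
a relation `P` of `g` and of `0` for an additional generator shows that the composite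
`U(F) → F → g` vanishes on the two-sided ideal generated by the relations
(`evalProj_mul_ι_mul`). An element `x` of `g` that dies in `U(g)` is therefore equal to `0`.
-/

namespace EnvelopingDuality

section

attribute [local instance 100] LieRing.ofAssociativeRing

open Module UniversalEnvelopingAlgebra

/-! ### Free Lie algebras embed into their enveloping algebras -/

section FreeLie

variable {k X : Type*} [Field k]

theorem freeLie_mem_of_forall_of_mem (S : LieSubalgebra k (FreeLieAlgebra k X))
    (h : ∀ x, FreeLieAlgebra.of k x ∈ S) (P : FreeLieAlgebra k X) : P ∈ S := by
  let φ : FreeLieAlgebra k X →ₗ⁅k⁆ S := FreeLieAlgebra.lift k fun x => ⟨FreeLieAlgebra.of k x, h x⟩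
  have hφ : S.incl.comp φ = LieHom.id := by
    ext x
    simp [φ]
  have := (φ P).2
  rwa [show ((φ P : S) : FreeLieAlgebra k X) = P from LieHom.congr_fun hφ P] at this

variable (k X)

/-- The representation of the free Lie algebra `F` on `F × k` in which a generator `x` acts by
`(f, c) ↦ (⁅x, f⁆ + c • x, 0)`: the adjoint representation, made affine by the cocycle
`degreeMap`. -/
noncomputable def affineRep :
    FreeLieAlgebra k X →ₗ⁅k⁆ Module.End k (FreeLieAlgebra k X × k) :=
  FreeLieAlgebra.lift k fun x =>
    (LinearMap.inl k (FreeLieAlgebra k X) k) ∘ₗ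
      ((LieAlgebra.ad k _ (FreeLieAlgebra.of k x) : _ →ₗ[k] _) ∘ₗ LinearMap.fst k _ _ +
        (LinearMap.toSpanSingleton k _ (FreeLieAlgebra.of k x)) ∘ₗ LinearMap.snd k _ _)

/-- The derivation of the free Lie algebra that fixes the generators: on brackets of `n` generators
it is multiplication by `n`. It is read off from the translation part of `affineRep`. -/
noncomputable def degreeMap : Module.End k (FreeLieAlgebra k X) where
  toFun P := (affineRep k X P (0, 1)).1
  map_add' P Q := by simp
  map_smul' c P := by simp

variable {k X}

theorem degreeMap_apply (P : FreeLieAlgebra k X) :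
    degreeMap k X P = (affineRep k X P (0, 1)).1 := rfl

theorem affineRep_of (x : X) (f : FreeLieAlgebra k X) (c : k) :
    affineRep k X (FreeLieAlgebra.of k x) (f, c) =
      (⁅FreeLieAlgebra.of k x, f⁆ + c • FreeLieAlgebra.of k x, 0) := by
  simp [affineRep]

theorem degreeMap_of (x : X) :
    degreeMap k X (FreeLieAlgebra.of k x) = FreeLieAlgebra.of k x := by
  simp [degreeMap_apply, affineRep_of]

theorem affineRep_apply (P f : FreeLieAlgebra k X) (c : k) :
    affineRep k X P (f, c) = (⁅P, f⁆ + c • degreeMap k X P, 0) := by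
  revert f c
  let S : LieSubalgebra k (FreeLieAlgebra k X) :=
    { carrier := {P | ∀ f c, affineRep k X P (f, c) = (⁅P, f⁆ + c • degreeMap k X P, 0)}
      add_mem' := fun {P Q} hP hQ f c => by
        simp only [map_add, LinearMap.add_apply, hP f c, hQ f c, Prod.mk_add_mk, add_lie, smul_add,
          add_zero]
        congr 1
        abel
      zero_mem' := fun f c => by simp [Prod.ext_iff]
      smul_mem' := fun a P hP f c => by
        simp only [map_smul, LinearMap.smul_apply, hP f c, Prod.smul_mk, smul_lie, smul_add,
          smul_zero, smul_comm a c]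
      lie_mem' := fun {P Q} hP hQ f c => by
        have h : ∀ f c, affineRep k X ⁅P, Q⁆ (f, c) =
            (⁅P, ⁅Q, f⁆ + c • degreeMap k X Q⁆ - ⁅Q, ⁅P, f⁆ + c • degreeMap k X P⁆, 0) := by
          intro f c
          rw [LieHom.map_lie, LieRing.of_associative_ring_bracket, LinearMap.sub_apply,
            Module.End.mul_apply, Module.End.mul_apply, hP f c, hQ f c, hP _ 0, hQ _ 0]
          simp
        rw [degreeMap_apply, h, h]
        simp only [lie_add, lie_smul, lie_zero, zero_add, one_smul, smul_sub, lie_lie]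
        congr 1
        abel }
  exact freeLie_mem_of_forall_of_mem S (fun x f c => by rw [affineRep_of, degreeMap_of]) P

theorem degreeMap_lie (P Q : FreeLieAlgebra k X) :
    degreeMap k X ⁅P, Q⁆ = ⁅P, degreeMap k X Q⁆ + ⁅degreeMap k X P, Q⁆ := by
  rw [degreeMap_apply, LieHom.map_lie, LieRing.of_associative_ring_bracket, LinearMap.sub_apply,
    Module.End.mul_apply, Module.End.mul_apply, affineRep_apply, affineRep_apply, affineRep_apply,
    affineRep_apply]
  rw [← lie_skew (degreeMap k X P) Q]
  simp [sub_eq_add_neg]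

/-- The free Lie algebra is spanned by eigenvectors of positive integral degree. -/
theorem mem_iSup_eigenspace_degreeMap (P : FreeLieAlgebra k X) :
    P ∈ ⨆ n : ℕ, End.eigenspace (degreeMap k X) ((n + 1 : ℕ) : k) := by
  let V : Submodule k (FreeLieAlgebra k X) :=
    ⨆ n : ℕ, End.eigenspace (degreeMap k X) ((n + 1 : ℕ) : k)
  let S : LieSubalgebra k (FreeLieAlgebra k X) :=
    { V with
      lie_mem' := fun {P Q} hP hQ => by
        change P ∈ V at hP
        change Q ∈ V at hQ
        change ⁅P, Q⁆ ∈ V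
        induction hP using Submodule.iSup_induction' with
        | zero => simp
        | add P P' _ _ h h' => rw [add_lie]; exact V.add_mem h h'
        | mem m P hP =>
          induction hQ using Submodule.iSup_induction' with
          | zero => simp
          | add Q Q' _ _ h h' => rw [lie_add]; exact V.add_mem h h'
          | mem n Q hQ =>
            refine Submodule.mem_iSup_of_mem (m + n + 1) ?_
            rw [End.mem_eigenspace_iff] at hP hQ ⊢
            rw [degreeMap_lie, hP, hQ, lie_smul, smul_lie, ← add_smul]
            push_cast
            congr 1
            ring }
  refine freeLie_mem_of_forall_of_mem S (fun x => ?_) P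
  refine Submodule.mem_iSup_of_mem (p := fun n : ℕ =>
    End.eigenspace (degreeMap k X) ((n + 1 : ℕ) : k)) 0 ?_
  rw [End.mem_eigenspace_iff, degreeMap_of]
  simp

theorem degreeMap_eq_zero [CharZero k] {P : FreeLieAlgebra k X} (h : degreeMap k X P = 0) :
    P = 0 := by
  have h0 : P ∈ End.eigenspace (degreeMap k X) 0 := by
    rw [End.mem_eigenspace_iff, h, zero_smul]
  have h1 : P ∈ ⨆ μ ≠ (0 : k), End.eigenspace (degreeMap k X) μ :=
    (iSup_le fun n : ℕ => le_iSup₂_of_le (f := fun μ (_ : μ ≠ (0 : k)) =>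
      End.eigenspace (degreeMap k X) μ) ((n + 1 : ℕ) : k) (Nat.cast_ne_zero.2 n.succ_ne_zero)
      le_rfl) (mem_iSup_eigenspace_degreeMap P)
  exact Submodule.disjoint_def.1 ((degreeMap k X).eigenspaces_iSupIndep 0) P h0 h1

theorem freeLie_ι_injective [CharZero k] :
    Function.Injective (ι k : FreeLieAlgebra k X →ₗ⁅k⁆ _) := by
  rw [injective_iff_map_eq_zero]
  intro P hP
  refine degreeMap_eq_zero ?_
  rw [degreeMap_apply, ← lift_ι_apply k (affineRep k X) P, hP]
  simp

end FreeLie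

/-! ### The square of the identity under convolution -/

section Adams

variable (k g : Type*) [Field k] [LieRing g] [LieAlgebra k g]

local notation "U" => UniversalEnvelopingAlgebra k g

/-- The Adams operation `u ↦ ∑ u₍₁₎ u₍₂₎` of `U(g)`, the convolution square of the identity. -/
noncomputable def adams : Module.End k U := LinearMap.mul' k U ∘ₗ (comul k g).toLinearMap

/-- The span of `1` and `g` in `U(g)`; its `n`-th power is the space of elements of degree at most
`n`. -/
noncomputable def degreeLEOne : Submodule k U :=
  1 ⊔ LinearMap.range (ι k : g →ₗ⁅k⁆ U).toLinearMap

local notation "M" => degreeLEOne k g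

variable {k g}

theorem adams_apply (u : U) : adams k g u = LinearMap.mul' k U (comul k g u) := rfl

theorem one_le_degreeLEOne : 1 ≤ M := le_sup_left

theorem ι_mem_degreeLEOne (x : g) : ι k x ∈ M := le_sup_right (α := Submodule k U) ⟨x, rfl⟩

theorem mem_degreeLEOne {m : U} : m ∈ M ↔ ∃ (c : k) (x : g), m = algebraMap k U c + ι k x := by
  rw [degreeLEOne, Submodule.mem_sup]
  constructor
  · rintro ⟨y, hy, _, ⟨x, rfl⟩, rfl⟩
    obtain ⟨c, rfl⟩ := Submodule.mem_one.1 hy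
    exact ⟨c, x, rfl⟩
  · rintro ⟨c, x, rfl⟩
    exact ⟨_, Submodule.mem_one.2 ⟨c, rfl⟩, _, ⟨x, rfl⟩, rfl⟩

theorem degreeLEOne_pow_mono : Monotone fun n : ℕ => M ^ n :=
  monotone_nat_of_le_succ fun n => by
    calc M ^ n = M ^ n * 1 := (mul_one _).symm
      _ ≤ M ^ n * M := mul_le_mul_right one_le_degreeLEOne _
      _ = M ^ (n + 1) := (pow_succ _ _).symm

theorem exists_mem_degreeLEOne_pow (u : U) : ∃ n : ℕ, u ∈ M ^ n := by
  let S : Subalgebra k U :=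
    { carrier := {u | ∃ n : ℕ, u ∈ M ^ n}
      mul_mem' := by
        rintro a b ⟨m, hm⟩ ⟨n, hn⟩
        exact ⟨m + n, by rw [pow_add]; exact Submodule.mul_mem_mul hm hn⟩
      add_mem' := by
        rintro a b ⟨m, hm⟩ ⟨n, hn⟩
        exact ⟨max m n, Submodule.add_mem _ (degreeLEOne_pow_mono (le_max_left m n) hm)
          (degreeLEOne_pow_mono (le_max_right m n) hn)⟩
      algebraMap_mem' := fun c => ⟨0, by rw [pow_zero]; exact Submodule.mem_one.2 ⟨c, rfl⟩⟩ }
  let j : g →ₗ⁅k⁆ S :=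
    { toFun := fun x => ⟨ι k x, 1, by rw [pow_one]; exact ι_mem_degreeLEOne x⟩
      map_add' := fun x y => Subtype.ext (by simp)
      map_smul' := fun c x => Subtype.ext (by simp)
      map_lie' := fun {x y} => Subtype.ext (by
        simp [LieRing.of_associative_ring_bracket]) }
  have h : S.val.comp (lift k j) = AlgHom.id k U := by
    apply UniversalEnvelopingAlgebra.hom_ext
    ext x
    simp only [LieHom.coe_comp, Function.comp_apply, AlgHom.coe_toLieHom, AlgHom.comp_apply,
      lift_ι_apply]
    rfl
  have h1 := (lift k j u).2
  rwa [show ((lift k j u : S) : U) = u from DFunLike.congr_fun h u] at h1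

theorem commutator_mem (x : g) {n : ℕ} {b : U} (hb : b ∈ M ^ n) :
    ι k x * b - b * ι k x ∈ M ^ n := by
  induction n generalizing b with
  | zero =>
    rw [pow_zero] at hb
    obtain ⟨c, rfl⟩ := Submodule.mem_one.1 hb
    rw [Algebra.commutes, sub_self]
    exact Submodule.zero_mem _
  | succ n ih =>
    rw [pow_succ] at hb ⊢
    induction hb using Submodule.mul_induction_on' with
    | mem_mul_mem b hb m hm =>
      have : ι k x * (b * m) - b * m * ι k x =
          (ι k x * b - b * ι k x) * m + b * (ι k x * m - m * ι k x) := by noncomm_ring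
      rw [this]
      refine Submodule.add_mem _ (Submodule.mul_mem_mul (ih hb) hm) (Submodule.mul_mem_mul hb ?_)
      obtain ⟨c, y, rfl⟩ := mem_degreeLEOne.1 hm
      have : ι k x * (algebraMap k U c + ι k y) - (algebraMap k U c + ι k y) * ι k x =
          ι k ⁅x, y⁆ := by
        rw [LieHom.map_lie, LieRing.of_associative_ring_bracket, mul_add, add_mul,
          Algebra.commutes]
        abel
      rw [this]
      exact ι_mem_degreeLEOne _
    | add a _ b _ ha hb =>
      rw [mul_add, add_mul, add_sub_add_comm]
      exact Submodule.add_mem _ ha hb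

variable (k g) in
/-- The space of tensors of total degree at most `n` in `U(g) ⊗ U(g)`. -/
def tensorDegreeLE (n : ℕ) : Submodule k (U ⊗[k] U) :=
  Submodule.span k {z | ∃ i j : ℕ, i + j = n ∧ ∃ a ∈ M ^ i, ∃ b ∈ M ^ j, a ⊗ₜ[k] b = z}

theorem tmul_mem_tensorDegreeLE {i j : ℕ} {a b : U} (ha : a ∈ M ^ i) (hb : b ∈ M ^ j) :
    a ⊗ₜ[k] b ∈ tensorDegreeLE k g (i + j) :=
  Submodule.subset_span ⟨i, j, rfl, a, ha, b, hb, rfl⟩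

theorem tensorDegreeLE_mul_le (m n : ℕ) :
    tensorDegreeLE k g m * tensorDegreeLE k g n ≤ tensorDegreeLE k g (m + n) := by
  rw [tensorDegreeLE, tensorDegreeLE, Submodule.span_mul_span, Submodule.span_le]
  rintro _ ⟨_, ⟨i, j, rfl, a, ha, b, hb, rfl⟩, _, ⟨i', j', rfl, a', ha', b', hb', rfl⟩, rfl⟩
  dsimp only
  rw [Algebra.TensorProduct.tmul_mul_tmul, add_add_add_comm]
  refine tmul_mem_tensorDegreeLE ?_ ?_
  · rw [pow_add]; exact Submodule.mul_mem_mul ha ha'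
  · rw [pow_add]; exact Submodule.mul_mem_mul hb hb'

theorem comul_mem_tensorDegreeLE {n : ℕ} {u : U} (hu : u ∈ M ^ n) :
    comul k g u ∈ tensorDegreeLE k g n := by
  induction n generalizing u with
  | zero =>
    rw [pow_zero] at hu
    obtain ⟨c, rfl⟩ := Submodule.mem_one.1 hu
    rw [AlgHom.commutes, Algebra.TensorProduct.algebraMap_apply]
    refine tmul_mem_tensorDegreeLE (i := 0) (j := 0) ?_ ?_ <;> rw [pow_zero]
    · exact Submodule.mem_one.2 ⟨c, rfl⟩
    · exact Submodule.one_le.1 le_rfl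
  | succ n ih =>
    rw [pow_succ] at hu
    induction hu using Submodule.mul_induction_on' with
    | mem_mul_mem u hu m hm =>
      rw [map_mul]
      refine tensorDegreeLE_mul_le n 1 (Submodule.mul_mem_mul (ih hu) ?_)
      have h1 : (1 : U) ∈ M ^ 0 := by rw [pow_zero]; exact Submodule.one_le.1 le_rfl
      have h : ∀ {m : U}, m ∈ M → m ∈ M ^ 1 := fun h => by rwa [pow_one]
      obtain ⟨c, x, rfl⟩ := mem_degreeLEOne.1 hm
      rw [map_add, comul_ι, AlgHom.commutes, Algebra.TensorProduct.algebraMap_apply]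
      refine Submodule.add_mem _ ?_ (Submodule.add_mem _ ?_ ?_)
      · exact tmul_mem_tensorDegreeLE (i := 1) (j := 0)
          (h (one_le_degreeLEOne (Submodule.mem_one.2 ⟨c, rfl⟩))) h1
      · exact tmul_mem_tensorDegreeLE (i := 1) (j := 0) (h (ι_mem_degreeLEOne x)) h1
      · exact tmul_mem_tensorDegreeLE (i := 0) (j := 1) h1 (h (ι_mem_degreeLEOne x))
    | add a _ b _ ha hb =>
      rw [map_add]
      exact Submodule.add_mem _ ha hb

/-- The correction term is `∑ u₍₁₎ (x u₍₂₎ - u₍₂₎ x)`, of the same degree as `u`. -/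
theorem adams_mul_ι_sub_mem {n : ℕ} {u : U} (hu : u ∈ M ^ n) (x : g) :
    adams k g (u * ι k x) - (2 : k) • (adams k g u * ι k x) ∈ M ^ n := by
  let κ : U ⊗[k] U →ₗ[k] U := LinearMap.mul' k U ∘ₗ
    LinearMap.lTensor U (LinearMap.mulLeft k (ι k x) - LinearMap.mulRight k (ι k x))
  have key : ∀ z : U ⊗[k] U, LinearMap.mul' k U (z * (ι k x ⊗ₜ[k] 1 + 1 ⊗ₜ[k] ι k x)) -
      (2 : k) • (LinearMap.mul' k U z * ι k x) = κ z := by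
    intro z
    induction z using TensorProduct.induction_on with
    | zero => simp
    | add z z' h h' => rw [map_add κ, ← h, ← h', add_mul, map_add, map_add, add_mul, smul_add]; abel
    | tmul a b =>
      simp only [mul_add, Algebra.TensorProduct.tmul_mul_tmul, map_add, LinearMap.mul'_apply,
        mul_one, κ, LinearMap.comp_apply, LinearMap.lTensor_tmul, LinearMap.sub_apply,
        LinearMap.mulLeft_apply, LinearMap.mulRight_apply, two_smul, mul_sub, mul_assoc]
      abel
  rw [adams_apply, adams_apply, map_mul, comul_ι, key]
  have hle : tensorDegreeLE k g n ≤ (M ^ n).comap κ := by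
    rw [tensorDegreeLE, Submodule.span_le]
    rintro _ ⟨i, j, rfl, a, ha, b, hb, rfl⟩
    rw [SetLike.mem_coe, Submodule.mem_comap, pow_add]
    exact Submodule.mul_mem_mul ha (commutator_mem x hb)
  exact hle (comul_mem_tensorDegreeLE hu)

theorem adams_one : adams k g 1 = 1 := by
  rw [adams_apply, map_one, Algebra.TensorProduct.one_def, LinearMap.mul'_apply, one_mul]

theorem adams_ι (x : g) : adams k g (ι k x) = (2 : k) • ι k x := by
  rw [adams_apply, comul_ι, map_add, LinearMap.mul'_apply, LinearMap.mul'_apply, one_mul, mul_one,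
    two_smul]

theorem adams_algebraMap (c : k) : adams k g (algebraMap k U c) = algebraMap k U c := by
  rw [Algebra.algebraMap_eq_smul_one, map_smul, adams_one]

/-- On the graded pieces of the degree filtration the Adams operation is multiplication by
`2 ^ n`. -/
theorem adams_sub_mem {n : ℕ} {u : U} (hu : u ∈ M ^ (n + 1)) :
    adams k g u - (2 : k) ^ (n + 1) • u ∈ M ^ n := by
  induction n generalizing u with
  | zero =>
    rw [zero_add, pow_one] at hu
    obtain ⟨c, x, rfl⟩ := mem_degreeLEOne.1 hu
    rw [map_add, adams_ι, adams_algebraMap, zero_add, pow_one, smul_add, add_sub_add_right_eq_sub,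
      Algebra.algebraMap_eq_smul_one, smul_smul, ← sub_smul, pow_zero,
      ← Algebra.algebraMap_eq_smul_one]
    exact Submodule.mem_one.2 ⟨_, rfl⟩
  | succ n ih =>
    rw [pow_succ M] at hu
    induction hu using Submodule.mul_induction_on' with
    | mem_mul_mem u hu m hm =>
      have hΨ : adams k g u ∈ M ^ (n + 1) := by
        rw [← sub_add_cancel (adams k g u) ((2 : k) ^ (n + 1) • u)]
        exact Submodule.add_mem _ (degreeLEOne_pow_mono n.le_succ (ih hu))
          (Submodule.smul_mem _ _ hu)
      obtain ⟨c, x, rfl⟩ := mem_degreeLEOne.1 hm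
      have hx : adams k g (u * ι k x) - (2 : k) ^ (n + 1 + 1) • (u * ι k x) ∈ M ^ (n + 1) := by
        have : adams k g (u * ι k x) - (2 : k) ^ (n + 1 + 1) • (u * ι k x) =
            (adams k g (u * ι k x) - (2 : k) • (adams k g u * ι k x)) +
            (2 : k) • ((adams k g u - (2 : k) ^ (n + 1) • u) * ι k x) := by
          rw [sub_mul, smul_sub, smul_mul_assoc, smul_smul, ← pow_succ']
          abel
        rw [this]
        refine Submodule.add_mem _ (adams_mul_ι_sub_mem hu x) (Submodule.smul_mem _ _ ?_)
        rw [pow_succ M]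
        exact Submodule.mul_mem_mul (ih hu) (ι_mem_degreeLEOne x)
      rw [mul_add, map_add, smul_add, add_sub_add_comm, ← Algebra.commutes, ← Algebra.smul_def,
        map_smul]
      exact Submodule.add_mem _ (Submodule.sub_mem _ (Submodule.smul_mem _ _ hΨ)
        (Submodule.smul_mem _ _ (Submodule.smul_mem _ _ hu))) hx
    | add a _ b _ ha hb =>
      rw [map_add, smul_add, add_sub_add_comm]
      exact Submodule.add_mem _ ha hb

variable [CharZero k]

theorem two_pow_inj {m n : ℕ} : (2 : k) ^ m = 2 ^ n ↔ m = n := by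
  constructor
  · intro h
    exact Nat.pow_right_injective le_rfl (by exact_mod_cast h)
  · rintro rfl; rfl

/-- Elements of degree at most `n` are sums of eigenvectors of the Adams operation for the
eigenvalues `2 ^ i`, `i ≤ n`. -/
theorem degreeLEOne_pow_le (n : ℕ) :
    M ^ n ≤ ⨆ i : Fin (n + 1), End.eigenspace (adams k g) (2 ^ (i : ℕ)) := by
  induction n with
  | zero =>
    intro u hu
    rw [pow_zero] at hu
    obtain ⟨c, rfl⟩ := Submodule.mem_one.1 hu
    refine Submodule.mem_iSup_of_mem (0 : Fin 1) ?_
    rw [End.mem_eigenspace_iff, adams_algebraMap]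
    simp
  | succ n ih =>
    intro u hu
    have hmono : (⨆ i : Fin (n + 1), End.eigenspace (adams k g) (2 ^ (i : ℕ))) ≤
        ⨆ i : Fin (n + 1 + 1), End.eigenspace (adams k g) (2 ^ (i : ℕ)) :=
      iSup_le fun i => le_iSup_of_le i.castSucc le_rfl
    -- `adams - 2 ^ (n + 1)` is invertible on the eigenspaces for the smaller powers of `2`.
    have hsurj : ∀ v ∈ ⨆ i : Fin (n + 1), End.eigenspace (adams k g) (2 ^ (i : ℕ)),
        ∃ w ∈ ⨆ i : Fin (n + 1), End.eigenspace (adams k g) (2 ^ (i : ℕ)),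
          adams k g w - (2 : k) ^ (n + 1) • w = v := by
      intro v hv
      induction hv using Submodule.iSup_induction' with
      | zero => exact ⟨0, Submodule.zero_mem _, by simp⟩
      | add v v' _ _ h h' =>
        obtain ⟨w, hw, rfl⟩ := h
        obtain ⟨w', hw', rfl⟩ := h'
        exact ⟨w + w', Submodule.add_mem _ hw hw', by rw [map_add, smul_add]; abel⟩
      | mem i v hv =>
        have hne : (2 : k) ^ (i : ℕ) - 2 ^ (n + 1) ≠ 0 :=
          sub_ne_zero.2 fun h => i.2.ne (two_pow_inj.1 h)
        refine ⟨((2 : k) ^ (i : ℕ) - 2 ^ (n + 1))⁻¹ • v,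
          Submodule.smul_mem _ _ (Submodule.mem_iSup_of_mem i hv), ?_⟩
        rw [map_smul, End.mem_eigenspace_iff.1 hv, smul_comm _ (_⁻¹ : k) v, ← smul_sub,
          ← sub_smul, smul_smul, inv_mul_cancel₀ hne, one_smul]
    obtain ⟨w, hw, h⟩ := hsurj _ (ih (adams_sub_mem hu))
    rw [← sub_add_cancel u w]
    refine Submodule.add_mem _ (Submodule.mem_iSup_of_mem (Fin.last (n + 1)) ?_) (hmono hw)
    rw [End.mem_eigenspace_iff, map_sub, Fin.val_last, smul_sub, ← sub_eq_zero, sub_sub_sub_comm, h,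
      sub_self]

theorem iSup_eigenspace_adams : ⨆ μ : k, End.eigenspace (adams k g) μ = ⊤ := by
  rw [eq_top_iff]
  intro u _
  obtain ⟨n, hn⟩ := exists_mem_degreeLEOne_pow u
  exact iSup_le (fun i : Fin (n + 1) => le_iSup (End.eigenspace (adams k g)) (2 ^ (i : ℕ)))
    (degreeLEOne_pow_le n hn)

/-- Primitive elements are eigenvectors of the Adams operation with eigenvalue `2`, so this contains
the fact that every primitive element of `U(g)` lies in `g`. -/
theorem eigenspace_adams_two :
    End.eigenspace (adams k g) 2 = LinearMap.range (ι k : g →ₗ⁅k⁆ U).toLinearMap := by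
  apply le_antisymm
  · intro u hu
    rw [End.mem_eigenspace_iff] at hu
    obtain ⟨n, hn⟩ := exists_mem_degreeLEOne_pow u
    have hdesc : ∀ n : ℕ, u ∈ M ^ (n + 1) → u ∈ M ^ 1 := by
      intro n
      induction n with
      | zero => exact id
      | succ n ih =>
        intro h
        refine ih ?_
        have h1 := adams_sub_mem h
        rw [hu, ← sub_smul] at h1
        refine (Submodule.smul_mem_iff _ ?_).1 h1
        refine sub_ne_zero.2 fun h => ?_
        have := two_pow_inj (k := k) (m := 1) (n := n + 1 + 1)
        rw [pow_one] at this
        have := this.1 h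
        omega
    have h1 := hdesc n (degreeLEOne_pow_mono n.le_succ hn)
    rw [pow_one] at h1
    obtain ⟨c, x, rfl⟩ := mem_degreeLEOne.1 h1
    rw [map_add, adams_ι, adams_algebraMap, smul_add, add_left_inj, two_smul, left_eq_add] at hu
    rw [hu, zero_add]
    exact ⟨x, rfl⟩
  · rintro _ ⟨x, rfl⟩
    exact End.mem_eigenspace_iff.2 (adams_ι x)

end Adams

/-! ### The projection of the enveloping algebra onto the Lie algebra -/

section Projection

variable {k L L' : Type*} [Field k] [LieRing L] [LieAlgebra k L]
  [LieRing L'] [LieAlgebra k L']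

/-- The algebra morphism `U(L) → U(L')` induced by a Lie algebra morphism. -/
noncomputable def envMap (f : L →ₗ⁅k⁆ L') :
    UniversalEnvelopingAlgebra k L →ₐ[k] UniversalEnvelopingAlgebra k L' :=
  lift k ((ι k).comp f)

theorem envMap_ι (f : L →ₗ⁅k⁆ L') (x : L) : envMap f (ι k x) = ι k (f x) := by
  rw [envMap, lift_ι_apply, LieHom.comp_apply]

theorem comul_envMap (f : L →ₗ⁅k⁆ L') (u : UniversalEnvelopingAlgebra k L) :
    comul k L' (envMap f u) = Algebra.TensorProduct.map (envMap f) (envMap f) (comul k L u) := by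
  have : (comul k L').comp (envMap f) =
      (Algebra.TensorProduct.map (envMap f) (envMap f)).comp (comul k L) := by
    apply UniversalEnvelopingAlgebra.hom_ext
    ext x
    simp only [LieHom.coe_comp, Function.comp_apply, AlgHom.coe_toLieHom, AlgHom.comp_apply,
      envMap_ι, comul_ι, map_add, Algebra.TensorProduct.map_tmul, map_one]
  exact DFunLike.congr_fun this u

theorem adams_envMap (f : L →ₗ⁅k⁆ L') (u : UniversalEnvelopingAlgebra k L) :
    adams k L' (envMap f u) = envMap f (adams k L u) := by
  rw [adams_apply, adams_apply, comul_envMap]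
  induction comul k L u using TensorProduct.induction_on with
  | zero => simp
  | add z z' h h' => simp only [map_add, h, h']
  | tmul a b => simp

variable [CharZero k]

theorem isCompl_range_ι : IsCompl
    (LinearMap.range (ι k : L →ₗ⁅k⁆ UniversalEnvelopingAlgebra k L).toLinearMap)
    (⨆ μ ≠ (2 : k), End.eigenspace (adams k L) μ) := by
  rw [← eigenspace_adams_two]
  refine ⟨(adams k L).eigenspaces_iSupIndep 2, ?_⟩
  rw [codisjoint_iff, eq_top_iff, ← iSup_eigenspace_adams]
  refine iSup_le fun μ => ?_
  by_cases h : μ = 2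
  · subst h
    exact le_sup_left
  · exact le_sup_of_le_right (le_iSup₂_of_le μ h le_rfl)

/-- For a Lie algebra `L` that embeds into `U(L)`, the projection of `U(L)` onto `L` along the
eigenspaces of the Adams operation for the eigenvalues other than `2`. -/
noncomputable def lieProj (h : Function.Injective (ι k : L →ₗ⁅k⁆ UniversalEnvelopingAlgebra k L)) :
    UniversalEnvelopingAlgebra k L →ₗ[k] L :=
  LinearMap.linearProjOfIsCompl _ (ι k : L →ₗ⁅k⁆ UniversalEnvelopingAlgebra k L).toLinearMap h
    isCompl_range_ι

variable {h : Function.Injective (ι k : L →ₗ⁅k⁆ UniversalEnvelopingAlgebra k L)}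
  {h' : Function.Injective (ι k : L' →ₗ⁅k⁆ UniversalEnvelopingAlgebra k L')}

theorem lieProj_ι (x : L) : lieProj h (ι k x) = x :=
  LinearMap.linearProjOfIsCompl_apply_left _
    (ι k : L →ₗ⁅k⁆ UniversalEnvelopingAlgebra k L).toLinearMap h isCompl_range_ι x

theorem lieProj_eq_zero {μ : k} (hμ : μ ≠ 2) {u : UniversalEnvelopingAlgebra k L}
    (hu : u ∈ End.eigenspace (adams k L) μ) : lieProj h u = 0 := by
  rw [lieProj, LinearMap.linearProjOfIsCompl, LinearMap.comp_apply,
    Submodule.projectionOnto_apply_of_mem_right, map_zero]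
  exact Submodule.mem_iSup_of_mem μ (Submodule.mem_iSup_of_mem hμ hu)

theorem lieProj_envMap (f : L →ₗ⁅k⁆ L') (u : UniversalEnvelopingAlgebra k L) :
    lieProj h' (envMap f u) = f (lieProj h u) := by
  have hu : u ∈ ⨆ μ : k, End.eigenspace (adams k L) μ := by
    rw [iSup_eigenspace_adams]
    trivial
  induction hu using Submodule.iSup_induction' with
  | zero => simp
  | add u v _ _ h h' => simp only [map_add, h, h']
  | mem μ u hu =>
    by_cases hμ : μ = 2
    · subst hμ
      rw [eigenspace_adams_two] at hu
      obtain ⟨x, rfl⟩ := hu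
      rw [LieHom.coe_toLinearMap, envMap_ι, lieProj_ι, lieProj_ι]
    · rw [lieProj_eq_zero hμ hu, map_zero]
      refine lieProj_eq_zero hμ ?_
      rw [End.mem_eigenspace_iff] at hu ⊢
      rw [adams_envMap, hu, map_smul]

end Projection

/-! ### Lie algebras embed into their enveloping algebras -/

section Embedding

variable {k g : Type*} [Field k] [LieRing g] [LieAlgebra k g]

variable (k g) in
/-- The canonical morphism onto `g` from the free Lie algebra on the underlying set of `g`. -/
noncomputable def freeLieEval : FreeLieAlgebra k g →ₗ⁅k⁆ g := FreeLieAlgebra.lift k id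

theorem freeLieEval_of (x : g) : freeLieEval k g (FreeLieAlgebra.of k x) = x := by
  simp [freeLieEval]

variable [CharZero k]

variable (k g) in
/-- The projection of `U(F)` onto the free Lie algebra `F` on `g`, followed by evaluation in `g`. -/
noncomputable def evalProj : UniversalEnvelopingAlgebra k (FreeLieAlgebra k g) →ₗ[k] g :=
  (freeLieEval k g).toLinearMap ∘ₗ lieProj freeLie_ι_injective

theorem evalProj_ι (P : FreeLieAlgebra k g) : evalProj k g (ι k P) = freeLieEval k g P := by
  rw [evalProj, LinearMap.comp_apply, lieProj_ι, LieHom.coe_toLinearMap]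

/-- If `P` is a relation of `g`, the ideal of `U(F)` that it generates is killed by the projection
to `g`. Adjoin a generator `*` to the free Lie algebra `F`: the projection of `u * v` is a Lie
polynomial, whose values in `g` at `* = P` and at `* = 0` agree. -/
theorem evalProj_mul_ι_mul {P : FreeLieAlgebra k g} (hP : freeLieEval k g P = 0)
    (u v : UniversalEnvelopingAlgebra k (FreeLieAlgebra k g)) :
    evalProj k g (u * ι k P * v) = 0 := by
  let j : FreeLieAlgebra k g →ₗ⁅k⁆ FreeLieAlgebra k (Option g) :=
    FreeLieAlgebra.lift k fun x => FreeLieAlgebra.of k (some x)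
  let φ : FreeLieAlgebra k g → (FreeLieAlgebra k (Option g) →ₗ⁅k⁆ FreeLieAlgebra k g) :=
    fun Q => FreeLieAlgebra.lift k fun o => o.elim Q (FreeLieAlgebra.of k)
  have hφ : ∀ Q, φ Q (FreeLieAlgebra.of k none) = Q := fun Q => by simp [φ]
  have hφj : ∀ Q w, envMap (φ Q) (envMap j w) = w := by
    intro Q w
    have : (envMap (φ Q)).comp (envMap j) = AlgHom.id k _ := by
      apply UniversalEnvelopingAlgebra.hom_ext
      ext x
      simp [-ι_apply, envMap_ι, j, φ]
    exact DFunLike.congr_fun this w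
  have hcomp : (freeLieEval k g).comp (φ P) = (freeLieEval k g).comp (φ 0) := by
    ext x
    cases x with
    | none => simp [φ, hP]
    | some x => simp [φ]
  let w := envMap j u * ι k (FreeLieAlgebra.of k none) * envMap j v
  have hw : ∀ Q, envMap (φ Q) w = u * ι k Q * v := fun Q => by
    rw [map_mul, map_mul, hφj, hφj, envMap_ι, hφ]
  have hev : ∀ Q, evalProj k g (envMap (φ Q) w) =
      (freeLieEval k g).comp (φ Q) (lieProj freeLie_ι_injective w) := fun Q => by
    rw [evalProj, LinearMap.comp_apply, lieProj_envMap (h := freeLie_ι_injective),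
      LieHom.coe_toLinearMap, LieHom.comp_apply]
  rw [← hw, hev, hcomp, ← hev, hw, map_zero (ι k), mul_zero, zero_mul, map_zero]

variable (k g) in
/-- Congruence modulo the largest two-sided ideal of `U(F)` on which `evalProj` vanishes. -/
noncomputable def evalCon : RingCon (UniversalEnvelopingAlgebra k (FreeLieAlgebra k g)) where
  r a b := ∀ u v, evalProj k g (u * (a - b) * v) = 0
  iseqv :=
    { refl := fun a u v => by simp
      symm := fun {a b} h u v => by
        rw [← neg_sub a b, mul_neg, neg_mul, map_neg, h, neg_zero]
      trans := fun {a b c} h h' u v => by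
        rw [← sub_add_sub_cancel a b c, mul_add, add_mul, map_add, h, h', add_zero] }
  add' := fun {a b c d} h h' u v => by
    rw [add_sub_add_comm, mul_add, add_mul, map_add, h, h', add_zero]
  mul' := fun {a b c d} h h' u v => by
    have : u * (a * c - b * d) * v = u * (a - b) * (c * v) + u * b * (c - d) * v := by noncomm_ring
    rw [this, map_add, h, h', add_zero]

/-- The Poincaré–Birkhoff–Witt theorem, in its weak form: `g` embeds into its enveloping algebra
because it embeds into the quotient of `U(F)` by `evalCon`. -/
theorem ι_injective : Function.Injective (ι k : g →ₗ⁅k⁆ UniversalEnvelopingAlgebra k g) := by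
  let q := RingCon.mkₐ k (evalCon k g)
  have hq : ∀ P Q : FreeLieAlgebra k g, freeLieEval k g P = freeLieEval k g Q →
      q (ι k P) = q (ι k Q) := by
    intro P Q h
    refine (RingCon.eq _).2 fun u v => ?_
    rw [← map_sub (ι k : FreeLieAlgebra k g →ₗ⁅k⁆ _)]
    exact evalProj_mul_ι_mul (by rw [map_sub, h, sub_self]) u v
  let θ : g →ₗ⁅k⁆ (evalCon k g).Quotient :=
    { toFun := fun x => q (ι k (FreeLieAlgebra.of k x))
      map_add' := fun x y => by
        rw [← map_add, ← map_add (ι k : FreeLieAlgebra k g →ₗ⁅k⁆ _)]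
        exact hq _ _ (by simp only [map_add, freeLieEval_of])
      map_smul' := fun c x => by
        rw [RingHom.id_apply, ← map_smul q, ← map_smul (ι k : FreeLieAlgebra k g →ₗ⁅k⁆ _)]
        exact hq _ _ (by simp only [map_smul, freeLieEval_of])
      map_lie' := fun {x y} => by
        rw [LieRing.of_associative_ring_bracket, ← map_mul q, ← map_mul q, ← map_sub q,
          ← LieRing.of_associative_ring_bracket, ← LieHom.map_lie]
        exact hq _ _ (by simp only [LieHom.map_lie, freeLieEval_of]) }
  rw [injective_iff_map_eq_zero]
  intro x hx
  have h : q (ι k (FreeLieAlgebra.of k x)) = q 0 := by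
    change θ x = _
    rw [← lift_ι_apply k θ x, hx, map_zero, map_zero]
  have h1 := (RingCon.eq (evalCon k g)).1 h 1 1
  rwa [one_mul, mul_one, sub_zero, evalProj_ι, freeLieEval_of] at h1

end Embedding

/-! ### Multiplicative families of linear forms -/

section Duality

variable {k g I : Type*} [Field k] [LieRing g] [LieAlgebra k g]

theorem mul'_map_eq_repr_tensorProduct {ι' : Type*}
    (B : Basis ι' k (UniversalEnvelopingAlgebra k g)) (a b : ι')
    (z : UniversalEnvelopingAlgebra k g ⊗[k] UniversalEnvelopingAlgebra k g) :
    LinearMap.mul' k k (TensorProduct.map (B.coord a) (B.coord b) z) =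
      (B.tensorProduct B).repr z (a, b) := by
  induction z using TensorProduct.induction_on with
  | zero => simp
  | add z z' h h' => simp only [map_add, h, h', Finsupp.add_apply]
  | tmul x y => simp [mul_comm]

variable {B : Basis (I →₀ ℕ) k (UniversalEnvelopingAlgebra k g)}

theorem repr_comul (h : ∀ α β, conv (B.coord α) (B.coord β) = B.coord (α + β))
    (u : UniversalEnvelopingAlgebra k g) (α β : I →₀ ℕ) :
    (B.tensorProduct B).repr (comul k g u) (α, β) = B.repr u (α + β) := by
  rw [← mul'_map_eq_repr_tensorProduct, ← B.coord_apply, ← h]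
  rfl

theorem repr_one_add (h : ∀ α β, conv (B.coord α) (B.coord β) = B.coord (α + β))
    (α β : I →₀ ℕ) : B.repr 1 (α + β) = B.repr 1 α * B.repr 1 β := by
  rw [← repr_comul h, map_one, Algebra.TensorProduct.one_def, Basis.tensorProduct_repr_tmul_apply]
  simp [mul_comm]

instance : Nontrivial (UniversalEnvelopingAlgebra k g) :=
  (lift k (0 : g →ₗ⁅k⁆ Module.End k k)).toRingHom.domain_nontrivial

theorem repr_one_zero (h : ∀ α β, conv (B.coord α) (B.coord β) = B.coord (α + β)) :
    B.repr 1 0 = 1 := by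
  have h0 : B.repr 1 0 ≠ 0 := fun h0 =>
    one_ne_zero (α := UniversalEnvelopingAlgebra k g) <| B.repr.map_eq_zero_iff.1 <|
      Finsupp.ext fun α => by rw [← zero_add α, repr_one_add h, h0, zero_mul, Finsupp.zero_apply]
  have h1 := repr_one_add h 0 0
  rw [add_zero] at h1
  exact (mul_eq_left₀ h0).1 h1.symm

/-- The coordinates of `1` form a finitely supported multiplicative character of `ℕ^(I)`, hence
vanish away from `0`. -/
theorem basis_zero_eq_one (h : ∀ α β, conv (B.coord α) (B.coord β) = B.coord (α + β)) :
    B 0 = 1 := by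
  classical
  refine (B.repr.injective ?_)
  ext α
  rw [B.repr_self]
  by_cases hα : α = 0
  · rw [hα, Finsupp.single_eq_same, repr_one_zero h]
  · rw [Finsupp.single_eq_of_ne hα]
    by_contra hne
    have hpow : ∀ n : ℕ, B.repr 1 (n • α) = B.repr 1 α ^ n := by
      intro n
      induction n with
      | zero => rw [zero_smul, pow_zero, repr_one_zero h]
      | succ n ih => rw [succ_nsmul, repr_one_add h, ih, pow_succ]
    have hinj : Function.Injective fun n : ℕ => n • α := by
      obtain ⟨i, hi⟩ := Finsupp.ne_iff.1 hα
      intro m n hmn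
      exact Nat.eq_of_mul_eq_mul_right (Nat.pos_of_ne_zero hi) (DFunLike.congr_fun hmn i)
    refine Set.infinite_of_injective_forall_mem hinj (fun n => ?_)
      (B.repr (1 : UniversalEnvelopingAlgebra k g)).hasFiniteSupport
    rw [Function.mem_support, hpow]
    exact pow_ne_zero n fun h => hne h.symm

theorem comul_basis_single (h : ∀ α β, conv (B.coord α) (B.coord β) = B.coord (α + β)) (i : I) :
    comul k g (B (Finsupp.single i 1)) =
      B (Finsupp.single i 1) ⊗ₜ[k] 1 + 1 ⊗ₜ[k] B (Finsupp.single i 1) := by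
  classical
  refine (B.tensorProduct B).repr.injective ?_
  ext ⟨α, β⟩
  rw [repr_comul h, ← basis_zero_eq_one h, map_add (B.tensorProduct B).repr, Finsupp.add_apply,
    Basis.tensorProduct_repr_tmul_apply, Basis.tensorProduct_repr_tmul_apply]
  simp only [B.repr_self, Finsupp.single_apply, smul_eq_mul]
  have hi : Finsupp.single i 1 ≠ (0 : I →₀ ℕ) := by simp
  by_cases hα : α = 0
  · subst hα
    simp [hi, eq_comm]
  by_cases hβ : β = 0
  · subst hβ
    simp [hi, eq_comm]
  have hne : Finsupp.single i 1 ≠ α + β := fun h => by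
    have hdeg := congrArg Finsupp.degree h
    rw [Finsupp.degree_single, map_add] at hdeg
    have hα' := mt (Finsupp.degree_eq_zero_iff α).1 hα
    have hβ' := mt (Finsupp.degree_eq_zero_iff β).1 hβ
    omega
  rw [if_neg hne, if_neg (Ne.symm hα), if_neg (Ne.symm hβ), mul_zero, zero_mul, add_zero]

theorem repr_ι_eq_zero (h : ∀ α β, conv (B.coord α) (B.coord β) = B.coord (α + β)) (x : g)
    {α : I →₀ ℕ} (hα : ∀ i, α ≠ Finsupp.single i 1) : B.repr (ι k x) α = 0 := by
  have key : ∀ β γ, B.repr (ι k x) (β + γ) =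
      B.repr (ι k x) β * B.repr 1 γ + B.repr 1 β * B.repr (ι k x) γ := by
    intro β γ
    rw [← repr_comul h, comul_ι, map_add, Finsupp.add_apply,
      Basis.tensorProduct_repr_tmul_apply, Basis.tensorProduct_repr_tmul_apply]
    simp [mul_comm]
  have hone : ∀ β : I →₀ ℕ, β ≠ 0 → B.repr 1 β = 0 := fun β hβ => by
    rw [← basis_zero_eq_one h, B.repr_self, Finsupp.single_eq_of_ne hβ]
  by_cases h0 : α = 0
  · have h1 := key 0 0
    rw [add_zero, repr_one_zero h, mul_one, one_mul, left_eq_add] at h1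
    rw [h0, h1]
  · obtain ⟨i, hi⟩ := Finsupp.ne_iff.1 h0
    have hle : Finsupp.single i 1 ≤ α := Finsupp.single_le_iff.2 (Nat.pos_of_ne_zero hi)
    have hadd : Finsupp.single i 1 + (α - Finsupp.single i 1) = α := add_tsub_cancel_of_le hle
    have hne : α - Finsupp.single i 1 ≠ 0 := fun h => hα i (by rw [← hadd, h, add_zero])
    rw [← hadd, key, hone _ hne, hone (Finsupp.single i 1) (by simp), mul_zero, zero_mul, add_zero]

/-- A basis of `U(g)` whose coordinate forms multiply like monomials under convolution restricts to
a basis of `g`. -/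
theorem exists_basis_of_conv_coord [CharZero k]
    (h : ∀ α β, conv (B.coord α) (B.coord β) = B.coord (α + β)) :
    ∃ b : Basis I k g, ∀ i, ι k (b i) = B (Finsupp.single i 1) := by
  have hprim : ∀ i : I, ∃ x : g, ι k x = B (Finsupp.single i 1) := by
    intro i
    have hi : B (Finsupp.single i 1) ∈ End.eigenspace (adams k g) 2 := by
      rw [End.mem_eigenspace_iff, adams_apply,
        comul_basis_single h, map_add, LinearMap.mul'_apply,
        LinearMap.mul'_apply, one_mul, mul_one, two_smul]
    rw [eigenspace_adams_two] at hi
    exact hi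
  choose b hb using hprim
  have hker : LinearMap.ker (ι k : g →ₗ⁅k⁆ UniversalEnvelopingAlgebra k g).toLinearMap = ⊥ :=
    LinearMap.ker_eq_bot.2 ι_injective
  have hcomp : (ι k : g →ₗ⁅k⁆ UniversalEnvelopingAlgebra k g).toLinearMap ∘ b =
      fun i => B (Finsupp.single i 1) := funext hb
  have hli : LinearIndependent k b := by
    rw [← LinearMap.linearIndependent_iff _ hker, hcomp]
    exact B.linearIndependent.comp _ (Finsupp.single_left_injective one_ne_zero)
  have hspan : ⊤ ≤ Submodule.span k (Set.range b) := by
    intro x _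
    have hx : ι k x ∈
        (Submodule.span k (Set.range b)).map
          (ι k : g →ₗ⁅k⁆ UniversalEnvelopingAlgebra k g).toLinearMap := by
      rw [Submodule.map_span, ← Set.range_comp, hcomp,
        ← B.linearCombination_repr (ι k x),
        Finsupp.linearCombination_apply]
      refine Submodule.sum_mem _ fun α hα => Submodule.smul_mem _ _ ?_
      by_contra hne
      refine Finsupp.mem_support_iff.1 hα (repr_ι_eq_zero h x ?_)
      rintro i rfl
      exact hne (Submodule.subset_span ⟨i, rfl⟩)
    obtain ⟨y, hy, hyx⟩ := hx
    rwa [← ι_injective hyx]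
  exact ⟨Basis.mk hli hspan, fun i => by rw [Basis.mk_apply, hb]⟩

end Duality

end

end EnvelopingDuality

theorem theorem2 {k : Type*} {g : Type*} {I : Type*} [Field k] [CharZero k]
    [LieRing g] [LieAlgebra k g] [DecidableEq I]
    (T : (I →₀ ℕ) → Module.Dual k (UniversalEnvelopingAlgebra k g))
    (B : Module.Basis (I →₀ ℕ) k (UniversalEnvelopingAlgebra k g))
    (hmul : ∀ α β : I →₀ ℕ, EnvelopingDuality.conv (T α) (T β) = T (α + β))
    (hdual : ∀ α β : I →₀ ℕ, T α (B β) = if α = β then 1 else 0) :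
    ∃ b : Module.Basis I k g,
      ∀ i : I, UniversalEnvelopingAlgebra.ι k (b i) = B (Finsupp.single i 1) := by
  have hT : T = B.coord := by
    ext α : 1
    refine B.ext fun β => ?_
    rw [hdual, B.coord_apply, B.repr_self, Finsupp.single_apply]
    simp only [eq_comm]
  subst hT
  exact EnvelopingDuality.exists_basis_of_conv_coord hmul
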